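/- Let $\mathbf{t}:\mathbb{N}_0\to\{0,1\}$ be the Thue–Morse sequence, defined by $\mathbf{t}(0)=0$, $\mathbf{t}(2n)=\mathbf{t}(n)$ and $\mathbf{t}(2n+1)=1-\mathbf{t}(n)$ for $n\ge 0$. Let $\mathcal{Q}:\mathbb{N}_0\to\{0,1\}$ be the Thue–Morse Quarto sequence, defined by $\mathcal{Q}(0)=0$, $\mathcal{Q}(1)=1$ and, for $n\ge 0$, $$\mathcal{Q}(4n)=\mathcal{Q}(n),\quad \mathcal{Q}(4n+1)=1-\mathcal{Q}(n),\quad \mathcal{Q}(4n+2)=\mathcal{Q}(2n),\quad \mathcal{Q}(4n+3)=1-\mathcal{Q}(2n).$$ For a sequence $a:\mathbb{N}_0\to\{0,1\}$, let $p_a(n)$ be the number of distinct length-$n$ factors (blocks of $n$ consecutive terms) of the infinite word $a(0)a(1)a(2)\cdots$, and let $J_n$ be the set of length-$n$ factors of $\mathcal{Q}$ that are not factors of $\mathbf{t}$. Then for all integers $k\ge 4$, $$p_{\mathcal{Q}}(2^k)=13\cdot 2^{k-2}-2.$$ Moreover $p_{\mathcal{Q}}(2^k)=p_{\mathbf{t}}(2^k)+2^{k-2}$,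 where $p_{\mathbf{t}}(2^k)=3\cdot 2^k-2$, and $|J_{2^k}|=2^{k-2}$. -/

import Mathlib

/-- The Thue--Morse sequence with values in `{0, 1}`. In `Fin 2`, the map `x ↦ 1 - x` swaps
`0` and `1`. -/
def thueMorse (m : ℕ) : Fin 2 :=
  if m = 0 then 0
  else if m % 2 = 0 then thueMorse (m / 2)
  else 1 - thueMorse (m / 2)
termination_by m
decreasing_by all_goals omega

theorem thueMorse_zero : thueMorse 0 = 0 := by
  rw [thueMorse]; simp

theorem thueMorse_two_mul (n : ℕ) : thueMorse (2 * n) = thueMorse n := by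
  rcases Nat.eq_zero_or_pos n with rfl | hn
  · rfl
  · rw [thueMorse, if_neg (by omega), if_pos (by omega), show 2 * n / 2 = n by omega]

theorem thueMorse_two_mul_add_one (n : ℕ) : thueMorse (2 * n + 1) = 1 - thueMorse n := by
  rw [thueMorse, if_neg (by omega), if_neg (by omega), show (2 * n + 1) / 2 = n by omega]

/-- The Thue--Morse Quarto sequence, with values in `{0, 1}`: `Q 0 = 0`, `Q 1 = 1`,
`Q (4 n) = Q n`, `Q (4 n + 1) = 1 - Q n`, `Q (4 n + 2) = Q (2 n)`,
`Q (4 n + 3) = 1 - Q (2 n)`. -/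
def quarto (m : ℕ) : Fin 2 :=
  if m = 0 then 0
  else if m = 1 then 1
  else if m % 4 = 0 then quarto (m / 4)
  else if m % 4 = 1 then 1 - quarto (m / 4)
  else if m % 4 = 2 then quarto (2 * (m / 4))
  else 1 - quarto (2 * (m / 4))
termination_by m
decreasing_by all_goals omega

theorem quarto_zero : quarto 0 = 0 := by
  rw [quarto]; simp

theorem quarto_one : quarto 1 = 1 := by
  rw [quarto]; simp

theorem quarto_four_mul (n : ℕ) : quarto (4 * n) = quarto n := by
  rcases Nat.eq_zero_or_pos n with rfl | hn
  · rfl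
  · rw [quarto, if_neg (by omega), if_neg (by omega), if_pos (by omega),
      show 4 * n / 4 = n by omega]

theorem quarto_four_mul_add_one (n : ℕ) : quarto (4 * n + 1) = 1 - quarto n := by
  rcases Nat.eq_zero_or_pos n with rfl | hn
  · rw [quarto_zero]; exact quarto_one
  · rw [quarto, if_neg (by omega), if_neg (by omega), if_neg (by omega), if_pos (by omega),
      show (4 * n + 1) / 4 = n by omega]

theorem quarto_four_mul_add_two (n : ℕ) : quarto (4 * n + 2) = quarto (2 * n) := by
  rw [quarto, if_neg (by omega), if_neg (by omega), if_neg (by omega), if_neg (by omega),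
    if_pos (by omega), show (4 * n + 2) / 4 = n by omega]

theorem quarto_four_mul_add_three (n : ℕ) : quarto (4 * n + 3) = 1 - quarto (2 * n) := by
  rw [quarto, if_neg (by omega), if_neg (by omega), if_neg (by omega), if_neg (by omega),
    if_neg (by omega), show (4 * n + 3) / 4 = n by omega]

/-- The set of length-`n` factors (blocks of `n` consecutive letters) of the infinite binary word
`a 0, a 1, a 2, …`. -/
def factors (a : ℕ → Fin 2) (n : ℕ) : Set (Fin n → Fin 2) :=
  {w | ∃ i : ℕ, ∀ j : Fin n, w j = a (i + j)}

/-- The factor complexity: the number of distinct length-`n` factors of `a`. There are at most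
`2 ^ n` of them, so `Set.ncard` is a genuine count. -/
noncomputable def factorComplexity (a : ℕ → Fin 2) (n : ℕ) : ℕ :=
  (factors a n).ncard

/-- The length-`n` factors of the Quarto sequence that are not factors of the Thue--Morse
sequence. -/
def junctionFactors (n : ℕ) : Set (Fin n → Fin 2) :=
  factors quarto n \ factors thueMorse n

/-! Write t, Q for the two sequences. Away from index 0, Q obeys the recursion of t with the two
output letters swapped (`quarto_bit`). Hence Q on each dyadic block is a prefix of t or its
complement, and every factor of t occurs in Q. So p_Q(n) = p_t(n) + |J_n|.

Put n = 2^(m+2). A window of Q starting at or after 2^m comes, by m doublings, from a window of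
length 5, hence is a factor of t (`quarto_block_eq_thueMorse`). A window starting before 2^m
contains a block around some 2^(j+1) that desubstitution excludes from t
(`quarto_junction_block_ne`). These 2^m windows are pairwise distinct, since equality would give Q a
short period (`quarto_not_periodic`). So |J_n| = 2^m.

For p_t, a factor of length at least 4 has a unique parity of position, so it desubstitutes
uniquely; this gives the recursion `factorComplexity_thueMorse_split`. -/

theorem fin_two_one_sub_ne (x : Fin 2) : 1 - x ≠ x := by decide +revert

theorem fin_two_one_sub_one_sub (x : Fin 2) : 1 - (1 - x) = x := by decide +revert

theorem fin_two_one_sub_inj {x y : Fin 2} : 1 - x = 1 - y ↔ x = y := by decide +revert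

theorem fin_two_eq_one_sub {x y : Fin 2} : x ≠ y ↔ x = 1 - y := by decide +revert

/-! ### One-bit recursions and dyadic blocks -/

/-- Both identities fail at n = 0; this one exception separates Q from the Thue–Morse pattern. -/
theorem quarto_bit (n : ℕ) (hn : 1 ≤ n) :
    quarto (2 * n) = 1 - quarto n ∧ quarto (2 * n + 1) = quarto n := by
  induction n using Nat.strong_induction_on with
  | _ n ih =>
    rcases Nat.even_or_odd' n with ⟨m, rfl | rfl⟩
    · have h := (ih m (by omega) (by omega)).1
      rw [show 2 * (2 * m) = 4 * m by ring, quarto_four_mul, quarto_four_mul_add_one, h,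
        fin_two_one_sub_one_sub]
      exact ⟨rfl, rfl⟩
    · rw [show 2 * (2 * m + 1) = 4 * m + 2 by ring, quarto_four_mul_add_two,
        show 4 * m + 2 + 1 = 4 * m + 3 by ring, quarto_four_mul_add_three]
      rcases Nat.eq_zero_or_pos m with rfl | hm
      · rw [Nat.mul_zero, quarto_zero, Nat.zero_add, quarto_one]; exact ⟨rfl, rfl⟩
      · obtain ⟨h₁, h₂⟩ := ih m (by omega) hm
        rw [h₁, h₂, fin_two_one_sub_one_sub]; exact ⟨rfl, rfl⟩

theorem quarto_two_mul {n : ℕ} (hn : 1 ≤ n) : quarto (2 * n) = 1 - quarto n :=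
  (quarto_bit n hn).1

theorem quarto_two_mul_add_one {n : ℕ} (hn : 1 ≤ n) : quarto (2 * n + 1) = quarto n :=
  (quarto_bit n hn).2

theorem quarto_succ_ne (n : ℕ) : quarto (2 * n + 1) ≠ quarto (2 * n) := by
  rcases Nat.eq_zero_or_pos n with rfl | hn
  · rw [Nat.mul_zero, Nat.zero_add, quarto_zero, quarto_one]; decide
  · rw [quarto_two_mul hn, quarto_two_mul_add_one hn]; exact (fin_two_one_sub_ne _).symm

theorem thueMorse_succ_ne (n : ℕ) : thueMorse (2 * n + 1) ≠ thueMorse (2 * n) := by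
  rw [thueMorse_two_mul, thueMorse_two_mul_add_one]; exact fin_two_one_sub_ne _

theorem thueMorse_two_pow_add (j : ℕ) : ∀ i < 2 ^ j,
    thueMorse (2 ^ j + i) = 1 - thueMorse i := by
  induction j with
  | zero =>
    intro i hi
    obtain rfl : i = 0 := by simpa using hi
    simpa using thueMorse_two_mul_add_one 0
  | succ j ih =>
    intro i hi
    rw [pow_succ] at hi
    rcases Nat.even_or_odd' i with ⟨m, rfl | rfl⟩
    · rw [show 2 ^ (j + 1) + 2 * m = 2 * (2 ^ j + m) by ring, thueMorse_two_mul,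
        thueMorse_two_mul, ih m (by omega)]
    · rw [show 2 ^ (j + 1) + (2 * m + 1) = 2 * (2 ^ j + m) + 1 by ring,
        thueMorse_two_mul_add_one, thueMorse_two_mul_add_one, ih m (by omega)]

/-- On the dyadic block starting at `2 ^ j`, the Quarto sequence is a prefix of the Thue--Morse
sequence, complemented when `j` is even. -/
theorem quarto_two_pow_add (j : ℕ) : ∀ i < 2 ^ j,
    quarto (2 ^ j + i) = if Even j then 1 - thueMorse i else thueMorse i := by
  induction j with
  | zero =>
    intro i hi
    obtain rfl : i = 0 := by simpa using hi
    simp [thueMorse_zero, quarto_one]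
  | succ j ih =>
    intro i hi
    rw [pow_succ] at hi
    have hp : 0 < 2 ^ j := by positivity
    rcases Nat.even_or_odd' i with ⟨m, rfl | rfl⟩
    · rw [show 2 ^ (j + 1) + 2 * m = 2 * (2 ^ j + m) by ring, thueMorse_two_mul,
        quarto_two_mul (by omega), ih m (by omega)]
      by_cases h : Even j <;> simp [h, Nat.even_add_one]
    · rw [show 2 ^ (j + 1) + (2 * m + 1) = 2 * (2 ^ j + m) + 1 by ring,
        thueMorse_two_mul_add_one, quarto_two_mul_add_one (by omega), ih m (by omega)]
      by_cases h : Even j <;> simp [h, Nat.even_add_one]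

/-! ### Which Quarto windows are Thue–Morse factors -/

theorem factors_thueMorse_subset (n : ℕ) : factors thueMorse n ⊆ factors quarto n := by
  rintro w ⟨i, hi⟩
  -- The exponent is odd, so the block is uncomplemented, and large enough for the window to fit.
  refine ⟨2 ^ (2 * (i + n) + 1) + i, fun j => ?_⟩
  have h₁ : 2 * (i + n) + 1 < 2 ^ (2 * (i + n) + 1) := Nat.lt_two_pow_self
  have h₂ := j.isLt
  rw [hi j, add_assoc, quarto_two_pow_add _ _ (by omega), if_neg]
  simp

theorem thueMorse_exists_compl (p L : ℕ) :
    ∃ p', ∀ n < L, thueMorse (p' + n) = 1 - thueMorse (p + n) := by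
  refine ⟨2 ^ (p + L) + p, fun n hn => ?_⟩
  have h : p + L < 2 ^ (p + L) := Nat.lt_two_pow_self
  rw [add_assoc, thueMorse_two_pow_add _ _ (by omega)]

/-- Doubling complements relative to t, which is harmless as factors of t are closed under
complement. One letter is lost when s is odd. -/
theorem quarto_block_eq_thueMorse_double {s L : ℕ} (hs : 2 ≤ s)
    (h : ∃ p, ∀ n < L, thueMorse (p + n) = quarto (s / 2 + n)) :
    ∃ p, ∀ n < 2 * L - 1, thueMorse (p + n) = quarto (s + n) := by
  obtain ⟨p, hp⟩ := h
  obtain ⟨q, hq⟩ := thueMorse_exists_compl p L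
  refine ⟨2 * q + s % 2, fun n hn => ?_⟩
  obtain ⟨l, hl⟩ : ∃ l, l = (s % 2 + n) / 2 := ⟨_, rfl⟩
  have h₁ := hq l (by omega)
  rw [hp l (by omega)] at h₁
  rcases Nat.mod_two_eq_zero_or_one (s % 2 + n) with h₂ | h₂
  · rw [show 2 * q + s % 2 + n = 2 * (q + l) by omega, show s + n = 2 * (s / 2 + l) by omega,
      thueMorse_two_mul, quarto_two_mul (by omega), h₁]
  · rw [show 2 * q + s % 2 + n = 2 * (q + l) + 1 by omega,
      show s + n = 2 * (s / 2 + l) + 1 by omega,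
      thueMorse_two_mul_add_one, quarto_two_mul_add_one (by omega), h₁, fin_two_one_sub_one_sub]

theorem thueMorse_values :
    thueMorse 1 = 1 ∧ thueMorse 2 = 1 ∧ thueMorse 3 = 0 ∧ thueMorse 4 = 1 ∧ thueMorse 5 = 0 ∧
    thueMorse 6 = 0 ∧ thueMorse 7 = 1 ∧ thueMorse 8 = 1 ∧ thueMorse 9 = 0 ∧ thueMorse 10 = 0 ∧
    thueMorse 11 = 1 ∧ thueMorse 12 = 0 ∧ thueMorse 13 = 1 ∧ thueMorse 14 = 1 ∧
    thueMorse 15 = 0 := by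
  simp [thueMorse]

theorem quarto_values :
    quarto 2 = 0 ∧ quarto 3 = 1 ∧ quarto 4 = 1 ∧ quarto 5 = 0 ∧
    quarto 6 = 0 ∧ quarto 7 = 1 ∧ quarto 8 = 0 := by
  simp [quarto]

theorem thueMorse_exists_pair (x y : Fin 2) :
    ∃ p, thueMorse p = x ∧ thueMorse (p + 1) = y := by
  obtain ⟨h1, h2, h3, h4, h5, h6, -⟩ := thueMorse_values
  fin_cases x <;> fin_cases y
  · exact ⟨5, h5, h6⟩
  · exact ⟨0, thueMorse_zero, h1⟩
  · exact ⟨2, h2, h3⟩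
  · exact ⟨1, h1, h2⟩

theorem quarto_block_five (s : ℕ) (hs : 1 ≤ s) :
    ∃ p, ∀ n < 5, thueMorse (p + n) = quarto (s + n) := by
  by_cases hs4 : 4 ≤ s
  -- All pairs occur in t, and two doublings give lengths 2, 3, 5.
  · refine quarto_block_eq_thueMorse_double (L := 3) (by omega)
      (quarto_block_eq_thueMorse_double (L := 2) (by omega) ?_)
    obtain ⟨p, h₁, h₂⟩ := thueMorse_exists_pair (quarto (s / 2 / 2)) (quarto (s / 2 / 2 + 1))
    refine ⟨p, fun n hn => ?_⟩
    interval_cases n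
    · exact h₁
    · exact h₂
  · obtain ⟨h1, h2, h3, h4, h5, h6, h7, h8, h9, h10, h11, h12, h13, h14, h15⟩ := thueMorse_values
    obtain ⟨q2, q3, q4, q5, q6, q7, q8⟩ := quarto_values
    have q1 := quarto_one
    interval_cases s
    · refine ⟨11, fun n hn => ?_⟩
      interval_cases n <;> simp [*]
    · refine ⟨6, fun n hn => ?_⟩
      interval_cases n <;> simp [*]
    · refine ⟨7, fun n hn => ?_⟩
      interval_cases n <;> simp [*]

theorem quarto_block_eq_thueMorse (m : ℕ) : ∀ s, 2 ^ m ≤ s →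
    ∃ p, ∀ n < 2 ^ (m + 2) + 1, thueMorse (p + n) = quarto (s + n) := by
  induction m with
  | zero => intro s hs; exact quarto_block_five s (by simpa using hs)
  | succ m ih =>
    intro s hs
    have hp : 0 < 2 ^ m := by positivity
    rw [pow_succ] at hs
    obtain ⟨p, h⟩ := quarto_block_eq_thueMorse_double (by omega) (ih (s / 2) (by omega))
    exact ⟨p, fun n hn => h n (by rw [show m + 1 + 2 = m + 2 + 1 by ring, pow_succ] at hn; omega)⟩

/-- The block of the Quarto sequence at the positions from `2 ^ (j + 1) - 1` to `2 ^ (j + 3)`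
is not a factor of the Thue--Morse sequence. -/
theorem quarto_junction_block_ne (j : ℕ) : ∀ p, ¬ ∀ n, 2 ^ (j + 1) + n ≤ 2 ^ (j + 3) + 1 →
    thueMorse (p + n) = quarto (2 ^ (j + 1) - 1 + n) := by
  induction j with
  | zero =>
    intro p h
    norm_num at h
    obtain ⟨q2, q3, q4, q5, q6, q7, q8⟩ := quarto_values
    have e0 := (h 0 (by omega)).trans quarto_one
    have e1 := (h 1 (by omega)).trans q2
    have e2 := (h 2 (by omega)).trans q3
    have e3 := (h 3 (by omega)).trans q4
    have e4 := (h 4 (by omega)).trans q5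
    have e5 := (h 5 (by omega)).trans q6
    have e6 := (h 6 (by omega)).trans q7
    have e7 := (h 7 (by omega)).trans q8
    rcases Nat.even_or_odd' p with ⟨m, rfl | rfl⟩
    · have := thueMorse_succ_ne (m + 1)
      rw [show 2 * (m + 1) + 1 = 2 * m + 3 by ring, show 2 * (m + 1) = 2 * m + 2 by ring,
        e3, e2] at this
      exact this rfl
    · have f0 : thueMorse m = 0 := by
        rw [show 2 * m + 1 + 0 = 2 * m + 1 by ring, thueMorse_two_mul_add_one] at e0
        revert e0; generalize thueMorse m = x; decide +revert
      rw [show 2 * m + 1 + 1 = 2 * (m + 1) by ring, thueMorse_two_mul] at e1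
      rw [show 2 * m + 1 + 5 = 2 * (m + 3) by ring, thueMorse_two_mul] at e5
      rw [show 2 * m + 1 + 7 = 2 * (m + 4) by ring, thueMorse_two_mul] at e7
      rcases Nat.even_or_odd' m with ⟨l, rfl | rfl⟩
      · exact thueMorse_succ_ne l (e1.trans f0.symm)
      · have := thueMorse_succ_ne (l + 2)
        rw [show 2 * (l + 2) + 1 = 2 * l + 1 + 4 by ring,
          show 2 * (l + 2) = 2 * l + 1 + 3 by ring, e7, e5] at this
        exact this rfl
  | succ j ih =>
    intro p h
    have hp : 0 < 2 ^ j := by positivity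
    simp only [show j + 1 + 1 = j + 2 by ring, show j + 1 + 3 = j + 4 by ring] at h
    have a1 : 2 ^ (j + 1) = 2 * 2 ^ j := by ring
    have a2 : 2 ^ (j + 2) = 4 * 2 ^ j := by ring
    have a3 : 2 ^ (j + 3) = 8 * 2 ^ j := by ring
    have a4 : 2 ^ (j + 4) = 16 * 2 ^ j := by ring
    rw [a1, a3] at ih
    rw [a2, a4] at h
    generalize 2 ^ j = N at *
    rcases Nat.even_or_odd' p with ⟨m, rfl | rfl⟩
    -- An aligned pair of t, whose letters differ, meets Q(4N+1) = Q(4N+2).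
    · have e₁ := h 2 (by omega)
      have e₂ := h 3 (by omega)
      rw [show 4 * N - 1 + 2 = 2 * (2 * N) + 1 by omega, quarto_two_mul_add_one (by omega)] at e₁
      rw [show 4 * N - 1 + 3 = 2 * (2 * N + 1) by omega, quarto_two_mul (by omega),
        fin_two_eq_one_sub.1 (quarto_succ_ne N), fin_two_one_sub_one_sub] at e₂
      exact thueMorse_succ_ne (m + 1) (e₂.trans e₁.symm)
    -- The pairings now agree, so both sides desubstitute, up to a complement.
    · obtain ⟨q, hq⟩ := thueMorse_exists_compl m (8 * N)
      refine ih q fun n hn => ?_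
      rw [hq n (by omega)]
      rcases Nat.eq_zero_or_pos n with rfl | hn0
      · have e := h 0 (by omega)
        rw [Nat.add_zero, thueMorse_two_mul_add_one,
          show 4 * N - 1 + 0 = 2 * (2 * N - 1) + 1 by omega,
          quarto_two_mul_add_one (by omega)] at e
        exact e
      · have e := h (2 * n - 1) (by omega)
        rw [show 2 * m + 1 + (2 * n - 1) = 2 * (m + n) by omega, thueMorse_two_mul,
          show 4 * N - 1 + (2 * n - 1) = 2 * (2 * N - 1 + n) by omega,
          quarto_two_mul (by omega)] at e
        rw [e, fin_two_one_sub_one_sub]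

/-! ### Counting the junction factors -/

theorem quarto_not_periodic (m : ℕ) : ∀ d, 1 ≤ d → d < 2 ^ m →
    ¬ ∀ n, 2 ^ m ≤ n → n < 2 ^ (m + 2) → quarto n = quarto (n + d) := by
  induction m with
  | zero => intro d h₁ h₂; norm_num at h₂; omega
  | succ m ih =>
    intro d hd₁ hd₂ h
    have hp : 0 < 2 ^ m := by positivity
    have a1 : 2 ^ (m + 1) = 2 * 2 ^ m := by ring
    have a2 : 2 ^ (m + 2) = 4 * 2 ^ m := by ring
    have a3 : 2 ^ (m + 1 + 2) = 8 * 2 ^ m := by ring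
    rw [a2] at ih
    rw [a1, a3] at h
    rw [a1] at hd₂
    generalize 2 ^ m = N at *
    rcases Nat.even_or_odd' d with ⟨e, rfl | rfl⟩
    · refine ih e (by omega) (by omega) fun n hn₁ hn₂ => ?_
      have := h (2 * n) (by omega) (by omega)
      rwa [← mul_add, quarto_two_mul (by omega), quarto_two_mul (by omega),
        fin_two_one_sub_inj] at this
    -- With n = 2l - e, which is N or N + 1, the shift by d = 2e + 1 at 2n and 2n + 1 forces Q(2l) =
    -- Q(2l+1).
    · obtain ⟨l, hl⟩ : ∃ l, l = (N + e + 1) / 2 := ⟨_, rfl⟩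
      have e₁ := h (2 * (2 * l - e)) (by omega) (by omega)
      have e₂ := h (2 * (2 * l - e) + 1) (by omega) (by omega)
      rw [show 2 * (2 * l - e) + (2 * e + 1) = 2 * (2 * l) + 1 by omega,
        quarto_two_mul (by omega), quarto_two_mul_add_one (by omega)] at e₁
      rw [show 2 * (2 * l - e) + 1 + (2 * e + 1) = 2 * (2 * l + 1) by omega,
        quarto_two_mul_add_one (by omega), quarto_two_mul (by omega)] at e₂
      rw [e₂, fin_two_one_sub_one_sub] at e₁
      exact quarto_succ_ne l e₁

theorem junctionFactors_eq_image (m : ℕ) (hm : 2 ≤ m) :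
    junctionFactors (2 ^ (m + 2)) =
      (fun (i : ℕ) (j : Fin (2 ^ (m + 2))) => quarto (i + j)) '' Set.Iio (2 ^ m) := by
  ext w
  constructor
  · rintro ⟨⟨i, hi⟩, hw⟩
    refine ⟨i, ?_, funext fun j => (hi j).symm⟩
    by_contra hlt
    obtain ⟨p, hp⟩ := quarto_block_eq_thueMorse m i (not_lt.1 hlt)
    exact hw ⟨p, fun j => by rw [hi j, hp j (by omega)]⟩
  · rintro ⟨i, hi, rfl⟩
    refine ⟨⟨i, fun j => rfl⟩, ?_⟩
    rintro ⟨p, hp⟩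
    rw [Set.mem_Iio] at hi
    obtain ⟨l, rfl⟩ : ∃ l, m = l + 2 := ⟨m - 2, by omega⟩
    have hpos : 0 < 2 ^ l := by positivity
    have a2 : 2 ^ (l + 2) = 4 * 2 ^ l := by ring
    have a4 : 2 ^ (l + 2 + 2) = 16 * 2 ^ l := by ring
    -- The junction at 2^m works unless i = 0, when the window ends one letter short; the previous
    -- junction then serves.
    obtain ⟨j, hj₁, hj₂⟩ : ∃ j, i + 1 ≤ 2 ^ (j + 1) ∧ 2 ^ (j + 3) + 1 ≤ i + 2 ^ (l + 2 + 2) := by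
      rcases Nat.eq_zero_or_pos i with rfl | h
      · refine ⟨l, Nat.one_le_two_pow, ?_⟩
        rw [a4, show 2 ^ (l + 3) = 8 * 2 ^ l by ring]; omega
      · exact ⟨l + 1, hi, by rw [show l + 1 + 3 = l + 2 + 2 by ring]; omega⟩
    refine quarto_junction_block_ne j (p + (2 ^ (j + 1) - 1 - i)) fun n hn => ?_
    have := hp ⟨2 ^ (j + 1) - 1 - i + n, by omega⟩
    simp only at this
    rw [add_assoc, ← this]
    congr 1
    omega

theorem ncard_junctionFactors (m : ℕ) (hm : 2 ≤ m) :
    (junctionFactors (2 ^ (m + 2))).ncard = 2 ^ m := by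
  rw [junctionFactors_eq_image m hm, Set.InjOn.ncard_image, ← Finset.coe_Iio,
    Set.ncard_coe_finset, Nat.card_Iio]
  have key : ∀ i i', i < i' → i' < 2 ^ m →
      ¬ ∀ j : Fin (2 ^ (m + 2)), quarto (i + j) = quarto (i' + j) := by
    intro i i' h h' heq
    refine quarto_not_periodic m (i' - i) (by omega) (by omega) fun n hn₁ hn₂ => ?_
    have := heq ⟨n - i, by omega⟩
    simp only at this
    rwa [show i + (n - i) = n by omega, show i' + (n - i) = n + (i' - i) by omega] at this
  intro i hi i' hi' heq
  rcases lt_trichotomy i i' with h | h | h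
  · exact (key i i' h hi' fun j => congrFun heq j).elim
  · exact h
  · exact (key i' i h hi fun j => (congrFun heq j).symm).elim

/-! ### Thue–Morse complexity by desubstitution -/

/-- The image of a word of length `m` under the Thue--Morse morphism `0 ↦ 01`, `1 ↦ 10`, with
the first `c` letters dropped, cut to length `L` (and padded with `0` images if too short). -/
def morphWord (c m L : ℕ) (w : Fin m → Fin 2) (j : Fin L) : Fin 2 :=
  let x := if h : (j + c) / 2 < m then w ⟨(j + c) / 2, h⟩ else 0
  if (j + c) % 2 = 0 then x else 1 - x

theorem morphWord_factor {c m L : ℕ} (h : L + c ≤ 2 * m) (w : Fin m → Fin 2) (i : ℕ)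
    (hw : ∀ j : Fin m, w j = thueMorse (i + j)) (j : Fin L) :
    morphWord c m L w j = thueMorse (2 * i + c + j) := by
  have hj := j.isLt
  have hlt : (j + c) / 2 < m := by omega
  simp only [morphWord, dif_pos hlt, hw]
  split_ifs with hc
  · rw [← thueMorse_two_mul]; congr 1; omega
  · rw [← thueMorse_two_mul_add_one]; congr 1; omega

/-- At most one letter is cut at each end, so every image pair keeps a letter, which determines its
preimage. -/
theorem morphWord_injective {c m L : ℕ} (hc : c ≤ 1) (hL : 1 ≤ L) (h : 2 * m ≤ L + c + 1) :
    Function.Injective (morphWord c m L) := by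
  intro w w' heq
  funext l
  have hl := l.isLt
  have key : ∀ j : Fin L, (j + c) / 2 = (l : ℕ) → w l = w' l := by
    intro j hj
    have e := congrFun heq j
    simp only [morphWord, hj, hl, dif_pos, Fin.eta] at e
    split_ifs at e
    · exact e
    · exact fin_two_one_sub_inj.1 e
  rcases Nat.eq_zero_or_pos (l : ℕ) with h0 | h0
  · exact key ⟨0, by omega⟩ (by simp only; omega)
  · exact key ⟨2 * l - c, by omega⟩ (by simp only; omega)

theorem thueMorse_cube_free (r : ℕ) :
    ¬ (thueMorse r = thueMorse (r + 1) ∧ thueMorse (r + 1) = thueMorse (r + 2)) := by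
  rintro ⟨h₁, h₂⟩
  rcases Nat.even_or_odd' r with ⟨l, rfl | rfl⟩
  · exact thueMorse_succ_ne l h₁.symm
  · exact thueMorse_succ_ne (l + 1) h₂.symm

/-- Alternation across both pairings would give three equal consecutive letters of t at i'. -/
theorem thueMorse_even_odd_ne (i i' : ℕ) :
    ¬ ∀ n < 4, thueMorse (2 * i + n) = thueMorse (2 * i' + 1 + n) := by
  intro h
  have e0 := h 0 (by omega)
  have e1 := h 1 (by omega)
  have e2 := h 2 (by omega)
  have e3 := h 3 (by omega)
  rw [Nat.add_zero, Nat.add_zero, thueMorse_two_mul, thueMorse_two_mul_add_one] at e0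
  rw [show 2 * i' + 1 + 1 = 2 * (i' + 1) by ring, thueMorse_two_mul_add_one,
    thueMorse_two_mul] at e1
  rw [show 2 * i' + 1 + 2 = 2 * (i' + 1) + 1 by ring, show 2 * i + 2 = 2 * (i + 1) by ring,
    thueMorse_two_mul_add_one, thueMorse_two_mul] at e2
  rw [show 2 * i' + 1 + 3 = 2 * (i' + 2) by ring, show 2 * i + 3 = 2 * (i + 1) + 1 by ring,
    thueMorse_two_mul_add_one, thueMorse_two_mul] at e3
  refine thueMorse_cube_free i' ⟨?_, ?_⟩
  · rw [← e1, e0, fin_two_one_sub_one_sub]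
  · rw [← e3, e2, fin_two_one_sub_one_sub]

theorem factorComplexity_thueMorse_split {L m₀ m₁ : ℕ} (hL : 4 ≤ L) (h₀ : L ≤ 2 * m₀)
    (h₀' : 2 * m₀ ≤ L + 1) (h₁ : L + 1 ≤ 2 * m₁) (h₁' : 2 * m₁ ≤ L + 2) :
    factorComplexity thueMorse L =
      factorComplexity thueMorse m₀ + factorComplexity thueMorse m₁ := by
  have hunion : factors thueMorse L = morphWord 0 m₀ L '' factors thueMorse m₀ ∪
      morphWord 1 m₁ L '' factors thueMorse m₁ := by
    ext w
    constructor
    · rintro ⟨i, hi⟩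
      rcases Nat.even_or_odd' i with ⟨r, rfl | rfl⟩
      · exact Or.inl ⟨fun j => thueMorse (r + j), ⟨r, fun _ => rfl⟩, funext fun j => by
          rw [hi, morphWord_factor (by omega) _ r fun _ => rfl]; rfl⟩
      · exact Or.inr ⟨fun j => thueMorse (r + j), ⟨r, fun _ => rfl⟩, funext fun j => by
          rw [hi, morphWord_factor (by omega) _ r fun _ => rfl]⟩
    · rintro (⟨v, ⟨i, hi⟩, rfl⟩ | ⟨v, ⟨i, hi⟩, rfl⟩)
      · exact ⟨_, morphWord_factor (by omega) v i hi⟩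
      · exact ⟨_, morphWord_factor (by omega) v i hi⟩
  have hdisj : Disjoint (morphWord 0 m₀ L '' factors thueMorse m₀)
      (morphWord 1 m₁ L '' factors thueMorse m₁) := by
    rw [Set.disjoint_left]
    rintro _ ⟨v, ⟨i, hi⟩, rfl⟩ ⟨v', ⟨i', hi'⟩, heq⟩
    refine thueMorse_even_odd_ne i i' fun n hn => ?_
    have := congrFun heq ⟨n, by omega⟩
    rw [morphWord_factor (by omega) v' i' hi', morphWord_factor (by omega) v i hi] at this
    exact this.symm
  rw [factorComplexity, hunion, Set.ncard_union_eq hdisj (Set.toFinite _) (Set.toFinite _),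
    Set.ncard_image_of_injective _ (morphWord_injective (by omega) (by omega) (by omega)),
    Set.ncard_image_of_injective _ (morphWord_injective (by omega) (by omega) (by omega))]
  rfl

theorem factorComplexity_thueMorse_two : factorComplexity thueMorse 2 = 4 := by
  have : factors thueMorse 2 = Set.univ := by
    refine Set.eq_univ_of_forall fun w => ?_
    obtain ⟨p, h₀, h₁⟩ := thueMorse_exists_pair (w 0) (w 1)
    exact ⟨p, fun j => by fin_cases j; exacts [h₀.symm, h₁.symm]⟩
  rw [factorComplexity, this, Set.ncard_univ, Nat.card_eq_fintype_card]
  rfl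

theorem factorComplexity_thueMorse_three : factorComplexity thueMorse 3 = 6 := by
  have : factors thueMorse 3 =
      ((Finset.univ.filter fun w : Fin 3 → Fin 2 => ¬ (w 0 = w 1 ∧ w 1 = w 2) :
        Finset (Fin 3 → Fin 2)) : Set (Fin 3 → Fin 2)) := by
    ext w
    rw [Finset.mem_coe, Finset.mem_filter]
    constructor
    · rintro ⟨i, hi⟩
      refine ⟨Finset.mem_univ _, ?_⟩
      rw [hi 0, hi 1, hi 2]
      exact thueMorse_cube_free i
    · rintro ⟨-, h⟩
      obtain ⟨h1, h2, h3, h4, h5, h6, h7, -⟩ := thueMorse_values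
      have h0 := thueMorse_zero
      suffices ∃ i, w 0 = thueMorse i ∧ w 1 = thueMorse (i + 1) ∧ w 2 = thueMorse (i + 2) by
        obtain ⟨i, e₀, e₁, e₂⟩ := this
        exact ⟨i, fun j => by fin_cases j; exacts [e₀, e₁, e₂]⟩
      generalize w 0 = x at *
      generalize w 1 = y at *
      generalize w 2 = z at *
      fin_cases x <;> fin_cases y <;> fin_cases z
      · exact absurd ⟨rfl, rfl⟩ h
      · exact ⟨5, h5.symm, h6.symm, h7.symm⟩
      · exact ⟨3, h3.symm, h4.symm, h5.symm⟩
      · exact ⟨0, h0.symm, h1.symm, h2.symm⟩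
      · exact ⟨4, h4.symm, h5.symm, h6.symm⟩
      · exact ⟨2, h2.symm, h3.symm, h4.symm⟩
      · exact ⟨1, h1.symm, h2.symm, h3.symm⟩
      · exact absurd ⟨rfl, rfl⟩ h
  rw [factorComplexity, this, Set.ncard_coe_finset]
  decide

theorem factorComplexity_thueMorse_two_pow_add_one (k : ℕ) :
    factorComplexity thueMorse (2 ^ (k + 1) + 1) = 3 * 2 ^ (k + 1) := by
  induction k with
  | zero => exact factorComplexity_thueMorse_three
  | succ k ih =>
    have hp : 0 < 2 ^ k := by positivity
    have a1 : 2 ^ (k + 1) = 2 * 2 ^ k := by ring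
    have a2 : 2 ^ (k + 1 + 1) = 4 * 2 ^ k := by ring
    rw [factorComplexity_thueMorse_split (m₀ := 2 ^ (k + 1) + 1) (m₁ := 2 ^ (k + 1) + 1)
      (by omega) (by omega) (by omega) (by omega) (by omega), ih]
    omega

theorem factorComplexity_thueMorse_two_pow (k : ℕ) :
    factorComplexity thueMorse (2 ^ (k + 1)) + 2 = 3 * 2 ^ (k + 1) := by
  induction k with
  | zero => rw [Nat.zero_add, pow_one, factorComplexity_thueMorse_two]
  | succ k ih =>
    have hp : 0 < 2 ^ k := by positivity
    have a1 : 2 ^ (k + 1) = 2 * 2 ^ k := by ring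
    have a2 : 2 ^ (k + 1 + 1) = 4 * 2 ^ k := by ring
    rw [factorComplexity_thueMorse_split (m₀ := 2 ^ (k + 1)) (m₁ := 2 ^ (k + 1) + 1)
      (by omega) (by omega) (by omega) (by omega) (by omega),
      factorComplexity_thueMorse_two_pow_add_one]
    omega

/-! ### Complexity of the Quarto sequence -/

theorem factorComplexity_quarto (n : ℕ) :
    factorComplexity quarto n = factorComplexity thueMorse n + (junctionFactors n).ncard := by
  rw [add_comm]
  exact (Set.ncard_sdiff_add_ncard_of_subset (factors_thueMorse_subset n) (Set.toFinite _)).symm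

theorem theorem5p5 (k : ℕ) (hk : 4 ≤ k) :
    (factorComplexity quarto (2 ^ k) : ℤ) = 13 * 2 ^ (k - 2) - 2 ∧
    factorComplexity quarto (2 ^ k) = factorComplexity thueMorse (2 ^ k) + 2 ^ (k - 2) ∧
    (factorComplexity thueMorse (2 ^ k) : ℤ) = 3 * 2 ^ k - 2 ∧
    (junctionFactors (2 ^ k)).ncard = 2 ^ (k - 2) := by
  obtain ⟨m, rfl⟩ : ∃ m, k = m + 2 := ⟨k - 2, by omega⟩
  have hJ := ncard_junctionFactors m (by omega)
  have hQ := factorComplexity_quarto (2 ^ (m + 2))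
  have hT : (factorComplexity thueMorse (2 ^ (m + 2)) : ℤ) + 2 = 3 * 2 ^ (m + 2) := by
    exact_mod_cast factorComplexity_thueMorse_two_pow (m + 1)
  rw [hJ] at hQ
  rw [Nat.add_sub_cancel]
  refine ⟨?_, hQ, by linarith, hJ⟩
  rw [hQ]
  push_cast
  have h4 : (2 : ℤ) ^ (m + 2) = 4 * 2 ^ m := by ring
  linarith
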